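/- Let $(X,d)$ be a complete metric space and let $\mu$ be a doubling Borel measure on $X$: every ball has positive and finite measure, and there is a constant $C_d$ with $\mu(B(x,2r))\le C_d\,\mu(B(x,r))$ for all $x\in X$, $r>0$. Let $\Omega\subset X$ be a John domain with nonempty boundary $\partial\Omega$; that is, $\Omega$ is open and connected, and there are a point $x_0\in\Omega$ and a constant $c_J>0$ such that every $x\in\Omega$ can be joined to $x_0$ by a rectifiable curve $\sigma:[0,l]\to\Omega$, parametrized by arc length, with $\sigma(0)=x$, $\sigma(l)=x_0$ and $d(\sigma(t),X\setminus\Omega)\ge t/c_J$ for all $t\in[0,l]$. Let $1\le p<\infty$, $s,\tau\in(0,1)$ and $0\le\gamma<s$. Let $\phi:(0,\infty)\to(0,\infty)$ be increasing (i.e. nondecreasing) with the growth condition $\phi(2t)\le K\phi(t)$ for all $t>0$ and some constant $K$. Write $d(x)=d(x,\partial\Omega)$, $$w_\phi(x)=\phi(d(x)),\qquad v_{\phi,\gamma p}(x,y)=\min_{z\in\{x,y\}}d(z)^{\gamma p}\phi(d(z)).$$ Then $\Omega$ supports the $(w_\phi,v_{\phi,\gamma p})$-improved fractional $(p,p)$-Poincaré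 inequality: there is a constant $C<\infty$ such that $$\inf_{a\in\mathbb R}\|u-a\|_{L^p(\Omega,w_\phi\,d\mu)}\le C\left(\int_\Omega\int_{\Omega\cap\{z:\,d(z,y)\le\tau d(y)\}}\frac{|u(z)-u(y)|^p\,v_{\phi,\gamma p}(z,y)}{\mu[B(z,d(z,y))]\,d(z,y)^{sp}}\,d\mu(z)\,d\mu(y)\right)^{1/p}$$ for every $u\in L^p(\Omega,w_\phi\,d\mu)$ for which the right-hand side is finite. -/

import Mathlib

open MeasureTheory Metric Set
open scoped ENNReal NNReal

/-- A (globally) doubling Borel measure on a metric space: all balls have positive and finite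
measure, and `μ (2B) ≤ C μ (B)` for every ball `B`, with a constant `C` independent of `B`. -/
structure IsDoublingMeasure {X : Type*} [MetricSpace X] [MeasurableSpace X]
    (μ : Measure X) : Prop where
  ball_pos : ∀ (x : X) (r : ℝ), 0 < r → 0 < μ (ball x r)
  ball_lt_top : ∀ (x : X) (r : ℝ), 0 < r → μ (ball x r) < ∞
  doubling : ∃ C : ℝ≥0, ∀ (x : X) (r : ℝ), 0 < r → μ (ball x (2 * r)) ≤ C * μ (ball x r)

/-- A John domain: an open connected set `Ω` with a central point `x₀ ∈ Ω` and a constant `c > 0`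
such that every `x ∈ Ω` is joined to `x₀` by a rectifiable curve `σ : [0, l] → Ω`, parametrized by
arc length, with `σ 0 = x`, `σ l = x₀` and `dist (σ t, X \ Ω) ≥ t / c` for all `t ∈ [0, l]`. -/
structure IsJohnDomain {X : Type*} [MetricSpace X] (Ω : Set X) : Prop where
  isOpen : IsOpen Ω
  isConnected : IsConnected Ω
  exists_center : ∃ x₀ ∈ Ω, ∃ c : ℝ, 0 < c ∧ ∀ x ∈ Ω, ∃ l : ℝ, 0 ≤ l ∧ ∃ σ : ℝ → X,
    HasUnitSpeedOn σ (Icc 0 l) ∧ MapsTo σ (Icc 0 l) Ω ∧ σ 0 = x ∧ σ l = x₀ ∧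
      ∀ t ∈ Icc (0 : ℝ) l, t / c ≤ infDist (σ t) Ωᶜ

/-- The distance `d(x) = d(x, ∂Ω)` to the boundary of `Ω`. -/
noncomputable def bdryDist {X : Type*} [MetricSpace X] (Ω : Set X) (x : X) : ℝ :=
  infDist x (frontier Ω)

/-- The weight `w_φ(x) = φ(d(x))`. -/
noncomputable def wWeight {X : Type*} [MetricSpace X] (Ω : Set X) (φ : ℝ → ℝ) (x : X) : ℝ :=
  φ (bdryDist Ω x)

/-- The weight `v_{φ,β}(x, y) = min_{z ∈ {x, y}} d(z)^β φ(d(z))`. -/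
noncomputable def vWeight {X : Type*} [MetricSpace X] (Ω : Set X) (φ : ℝ → ℝ) (β : ℝ)
    (x y : X) : ℝ :=
  min (bdryDist Ω x ^ β * φ (bdryDist Ω x)) (bdryDist Ω y ^ β * φ (bdryDist Ω y))

/-- The weighted fractional seminorm `[u]_{W^{s,p}_τ(Ω, v dμ)}`, with values in `[0, ∞]`. The
integrand vanishes on the diagonal, since `0 / 0 = 0`. -/
noncomputable def fracSeminorm {X : Type*} [MetricSpace X] [MeasurableSpace X] (μ : Measure X)
    (Ω : Set X) (s τ p : ℝ) (v : X → X → ℝ) (u : X → ℝ) : ℝ≥0∞ :=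
  (∫⁻ y in Ω, ∫⁻ z in Ω ∩ {z | dist z y ≤ τ * bdryDist Ω y},
      ENNReal.ofReal (|u z - u y| ^ p * v z y) /
        (μ (ball z (dist z y)) * ENNReal.ofReal (dist z y ^ (s * p))) ∂μ ∂μ) ^ (1 / p)

/-- The measure `w dμ` on `Ω`. -/
noncomputable def weightedMeasure {X : Type*} [MetricSpace X] [MeasurableSpace X] (μ : Measure X)
    (Ω : Set X) (w : X → ℝ) : Measure X :=
  (μ.restrict Ω).withDensity fun x => ENNReal.ofReal (w x)

/-- `Ω` supports the `(w, v)`-weighted fractional `(q, p)`-Poincaré inequality: there is a constant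
`C` such that `inf_a ‖u - a‖_{L^q(Ω, w dμ)} ≤ C [u]_{W^{s,p}_τ(Ω, v dμ)}` for every
`u ∈ L^q(Ω, w dμ)` whose seminorm on the right is finite. -/
def SupportsFracPoincare {X : Type*} [MetricSpace X] [MeasurableSpace X] (μ : Measure X)
    (Ω : Set X) (s τ q p : ℝ) (w : X → ℝ) (v : X → X → ℝ) : Prop :=
  ∃ C : ℝ≥0, ∀ u : X → ℝ,
    MemLp u (ENNReal.ofReal q) (weightedMeasure μ Ω w) →
    fracSeminorm μ Ω s τ p v u < ∞ →
    ⨅ a : ℝ, eLpNorm (fun x => u x - a) (ENNReal.ofReal q) (weightedMeasure μ Ω w) ≤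
      C * fracSeminorm μ Ω s τ p v u

/-! ### Doubling measures and doubling weights. -/

section Doubling

variable {X : Type*} [MetricSpace X] [MeasurableSpace X] {μ : Measure X}

/-! Let `E = fracEnergy` be the inner integral of the seminorm without its weight. On a ball well
inside `Ω`, `u` is close in `L^p` to a constant, with error governed by the integral of `E` over the
ball (`exists_forall_setLIntegral_ball_le`).

Join `x ∈ Ω` to the John center by balls centered on the John curve, with radii comparable to the
arc length `t` from `x` and decreasing geometrically towards `x` (`IsJohnDomain.exists_chain`). The
chain is finite: it stops at a ball lying in `{w | d(w,x) ≤ τ d(x)}`, where `E x` itself compares `u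
x` with the constant of the ball, so no Lebesgue differentiation is needed. In a chain ball `t ≲
d(w)` and `μ(B(w, d(w))) ≲ μ(B)`. Hence each jump between consecutive constants, raised to the power
`p`, is at most a multiple of `t^((s-γ)p)` times the potential `H x = ∫ E(w) d(w)^(γp) / μ(B(w,
d(w))) dμ(w)` over `d(x,w) ≤ L d(w)`. As `γ < s`, the jumps sum geometrically, and `|u - a|^p ≲
d^(γp) E + H` pointwise (`IsJohnDomain.exists_pointwise_bound`).

Integrate against `φ(d(x))` and apply Tonelli: for fixed `w`, the admissible `x` satisfy `φ(d(x)) ≲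
φ(d(w))` and fill a set of measure at most `C μ(B(w, d(w)))`, which cancels the denominator
(`exists_setLIntegral_mul_fracPotential_le`). Finally `d(z) ≥ (1-τ) d(y)` in the seminorm, so
`d(y)^(γp) φ(d(y))` is dominated by the minimum defining `vWeight`. -/

theorem IsDoublingMeasure.sigmaFinite (hμ : IsDoublingMeasure μ) : SigmaFinite μ := by
  rcases isEmpty_or_nonempty X with hX | ⟨⟨x⟩⟩
  · rw [Measure.eq_zero_of_isEmpty μ]
    infer_instance
  · refine ⟨⟨⟨fun n => ball x (n + 1), fun _ => trivial,
      fun n => hμ.ball_lt_top x _ (by positivity), ?_⟩⟩⟩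
    refine eq_univ_of_forall fun y => ?_
    obtain ⟨n, hn⟩ := exists_nat_gt (dist y x)
    exact mem_iUnion.2 ⟨n, by rw [mem_ball]; linarith⟩

/-- Half-radius balls around a maximal `ε`-separated set are disjoint with positive measure, so
σ-finiteness makes the set countable; maximality makes it an `ε`-net. This supplies measurability on
`X × X`. -/
theorem IsDoublingMeasure.secondCountableTopology [OpensMeasurableSpace X]
    (hμ : IsDoublingMeasure μ) : SecondCountableTopology X := by
  have := hμ.sigmaFinite
  refine secondCountable_of_almost_dense_set fun ε hε => ?_
  obtain ⟨S, hS⟩ := zorn_subset {S : Set X | S.Pairwise fun x y => ε ≤ dist x y}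
    fun c hc hchain => ⟨⋃₀ c, (pairwise_sUnion hchain.directedOn).2 fun s hs => hc hs,
      fun s hs => subset_sUnion_of_mem hs⟩
  have hSsep : S.Pairwise fun x y => ε ≤ dist x y := hS.prop
  refine ⟨S, ?_, fun x => ?_⟩
  · have h := Measure.countable_meas_pos_of_disjoint_iUnion (μ := μ)
      (As := fun x : S => ball (x : X) (ε / 2)) (fun _ => measurableSet_ball) (by
        intro x y hxy
        refine ball_disjoint_ball ?_
        have := hSsep x.2 y.2 (fun h => hxy (Subtype.ext h))
        linarith)
    have h' : {x : S | 0 < μ (ball (x : X) (ε / 2))} = univ :=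
      eq_univ_of_forall fun x => hμ.ball_pos _ _ (by positivity)
    rw [h'] at h
    exact countable_coe_iff.1 (countable_univ_iff.1 h)
  · by_contra! hx
    have hxS : x ∉ S := fun h => by
      have := hx x h
      simp only [dist_self] at this
      linarith
    refine hxS (hS.le_of_ge (y := insert x S) ?_ (subset_insert x S) (mem_insert x S))
    exact hSsep.insert fun y hy _ => ⟨(hx y hy).le, by rw [dist_comm]; exact (hx y hy).le⟩

theorem IsDoublingMeasure.measure_ball_ne_top (hμ : IsDoublingMeasure μ) (x : X) (r : ℝ) :
    μ (ball x r) ≠ ∞ := by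
  rcases le_or_gt r 0 with hr | hr
  · simp [ball_eq_empty.2 hr]
  · exact (hμ.ball_lt_top x r hr).ne

/-- Balls of comparable radii at comparable distance have comparable measure. -/
theorem IsDoublingMeasure.exists_measure_ball_le (hμ : IsDoublingMeasure μ) (L : ℝ) :
    ∃ C : ℝ≥0, ∀ (x y : X) (r R : ℝ), 0 < r → dist x y + R ≤ L * r →
      μ (ball x R) ≤ C * μ (ball y r) := by
  obtain ⟨C, hC⟩ := hμ.doubling
  obtain ⟨n, hn⟩ := pow_unbounded_of_one_lt L (one_lt_two : (1 : ℝ) < 2)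
  have key : ∀ (n : ℕ) (y : X) (r : ℝ), 0 < r → μ (ball y (2 ^ n * r)) ≤ C ^ n * μ (ball y r) := by
    intro n
    induction n with
    | zero => simp
    | succ n ih =>
      intro y r hr
      calc μ (ball y (2 ^ (n + 1) * r)) = μ (ball y (2 * (2 ^ n * r))) := by ring_nf
        _ ≤ C * μ (ball y (2 ^ n * r)) := hC _ _ (by positivity)
        _ ≤ C * (C ^ n * μ (ball y r)) := by gcongr; exact ih y r hr
        _ = C ^ (n + 1) * μ (ball y r) := by rw [pow_succ']; ring
  refine ⟨C ^ n, fun x y r R hr h => ?_⟩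
  calc μ (ball x R) ≤ μ (ball y (2 ^ n * r)) := by
        refine measure_mono (ball_subset_ball' ?_)
        nlinarith
    _ ≤ (C ^ n : ℝ≥0) * μ (ball y r) := by push_cast; exact key n y r hr

end Doubling

/-- Iterate the growth condition until `2 ^ n` exceeds `L`, then use monotonicity. Only this
one-sided comparison of `φ` is needed later. -/
theorem MonotoneOn.exists_le_mul_of_doubling {φ : ℝ → ℝ} (hpos : ∀ t, 0 < t → 0 < φ t)
    (hmono : MonotoneOn φ (Ioi 0)) (hdbl : ∃ K : ℝ, ∀ t, 0 < t → φ (2 * t) ≤ K * φ t) (L : ℝ) :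
    ∃ C : ℝ≥0, ∀ a b : ℝ, 0 < a → 0 < b → a ≤ L * b → φ a ≤ C * φ b := by
  obtain ⟨K, hK⟩ := hdbl
  obtain ⟨n, hn⟩ := pow_unbounded_of_one_lt L (one_lt_two : (1 : ℝ) < 2)
  have hK0 : 0 ≤ K := by
    have h1 := hK 1 one_pos
    have h2 := hpos 1 one_pos
    have h3 := hpos (2 * 1) (by norm_num)
    by_contra! h
    nlinarith
  have key : ∀ (n : ℕ) (b : ℝ), 0 < b → φ (2 ^ n * b) ≤ K ^ n * φ b := by
    intro n
    induction n with
    | zero => simp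
    | succ n ih =>
      intro b hb
      calc φ (2 ^ (n + 1) * b) = φ (2 * (2 ^ n * b)) := by ring_nf
        _ ≤ K * φ (2 ^ n * b) := hK _ (by positivity)
        _ ≤ K * (K ^ n * φ b) := by gcongr; exact ih b hb
        _ = K ^ (n + 1) * φ b := by ring
  refine ⟨⟨K ^ n, by positivity⟩, fun a b ha hb h => ?_⟩
  refine (hmono ha (show 0 < 2 ^ n * b by positivity) ?_).trans (key n b hb)
  nlinarith

/-! ### John curves and chains of balls. -/

section John

variable {X : Type*} [MetricSpace X] {Ω : Set X}

theorem bdryDist_pos (hΩ : IsOpen Ω) (hb : (frontier Ω).Nonempty) {x : X} (hx : x ∈ Ω) :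
    0 < bdryDist Ω x :=
  (isClosed_frontier.notMem_iff_infDist_pos hb).1
    fun h => (hΩ.inter_frontier_eq ▸ ⟨hx, h⟩ : x ∈ (∅ : Set X))

theorem bdryDist_le_add (x y : X) : bdryDist Ω x ≤ bdryDist Ω y + dist x y :=
  infDist_le_infDist_add_dist

theorem le_bdryDist_of_ball_subset (hΩ : IsOpen Ω) (hb : (frontier Ω).Nonempty) {x : X} {r : ℝ}
    (h : ball x r ⊆ Ω) : r ≤ bdryDist Ω x := by
  refine (le_infDist hb).2 fun y hy => ?_
  by_contra! hlt
  exact (hΩ.inter_frontier_eq ▸ ⟨h (by rwa [mem_ball, dist_comm]), hy⟩ : y ∈ (∅ : Set X))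

/-- In a John domain with nonempty boundary, the curves may be parametrized on one interval. -/
theorem IsJohnDomain.exists_curve (hΩ : IsJohnDomain Ω) (hb : (frontier Ω).Nonempty) :
    ∃ x₀ ∈ Ω, ∃ c T : ℝ, 1 ≤ c ∧ 0 < T ∧ ∀ x ∈ Ω, ∃ σ : ℝ → X, σ 0 = x ∧ σ T = x₀ ∧
      (∀ a ∈ Icc 0 T, ∀ b ∈ Icc 0 T, dist (σ a) (σ b) ≤ |a - b|) ∧
      ∀ t ∈ Icc 0 T, ball (σ t) (t / c) ⊆ Ω := by
  obtain ⟨x₀, hx₀, c, hc, h⟩ := hΩ.exists_center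
  have hne : Ωᶜ.Nonempty := by
    obtain ⟨y, hy⟩ := hb
    exact ⟨y, fun hyΩ => (hΩ.isOpen.inter_frontier_eq ▸ ⟨hyΩ, hy⟩ : y ∈ (∅ : Set X))⟩
  have hδ : 0 < infDist x₀ Ωᶜ :=
    (hΩ.isOpen.isClosed_compl.notMem_iff_infDist_pos hne).1 fun h => h hx₀
  -- The John condition at the endpoint `x₀` bounds every length `l` by `c * infDist x₀ Ωᶜ`, which
  -- serves as the common `T`; each curve then rests at `x₀` from time `l` on.
  refine ⟨x₀, hx₀, max c 1, c * infDist x₀ Ωᶜ, le_max_right _ _, by positivity, fun x hx => ?_⟩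
  obtain ⟨l, hl, σ, hσ, -, h0, h1, hJ⟩ := h x hx
  have hlT : l ≤ c * infDist x₀ Ωᶜ := by
    have := hJ l ⟨hl, le_rfl⟩
    rw [h1, div_le_iff₀ hc] at this
    linarith
  have hLip : ∀ a ∈ Icc 0 l, ∀ b ∈ Icc 0 l, dist (σ a) (σ b) ≤ |a - b| := by
    have aux : ∀ a ∈ Icc 0 l, ∀ b ∈ Icc 0 l, a ≤ b → dist (σ a) (σ b) ≤ |a - b| := by
      intro a ha b hb hab
      have h2 := hσ ha hb
      have h3 := eVariationOn.edist_le σ (s := Icc 0 l ∩ Icc a b)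
        ⟨ha, le_rfl, hab⟩ ⟨hb, hab, le_rfl⟩
      rw [h2, edist_dist, ENNReal.ofReal_le_ofReal_iff (by simpa using hab)] at h3
      rw [abs_sub_comm, abs_of_nonneg (sub_nonneg.2 hab)]
      simpa using h3
    intro a ha b hb
    rcases le_total a b with hab | hab
    · exact aux a ha b hb hab
    · rw [dist_comm, abs_sub_comm]
      exact aux b hb a ha hab
  refine ⟨fun t => σ (min t l), by simp [hl, h0], by simp [hlT, h1], fun a ha b hb => ?_,
    fun t ht => ?_⟩
  · refine (hLip _ ⟨le_min ha.1 hl, min_le_right _ _⟩ _ ⟨le_min hb.1 hl, min_le_right _ _⟩).trans ?_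
    simpa using abs_min_sub_min_le_max a l b l
  · have key : t / max c 1 ≤ infDist (σ (min t l)) Ωᶜ := by
      have h4 : t / max c 1 ≤ t / c := by
        gcongr
        · exact ht.1
        · exact le_max_left _ _
      refine h4.trans ?_
      rcases le_total t l with htl | htl
      · rw [min_eq_left htl]
        exact hJ t ⟨ht.1, htl⟩
      · rw [min_eq_right htl, h1, div_le_iff₀ hc]
        linarith [ht.2]
    intro y hy
    by_contra hyΩ
    have := infDist_le_dist_of_mem (x := σ (min t l)) (show y ∈ Ωᶜ from hyΩ)
    rw [mem_ball, dist_comm] at hy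
    linarith

/-- Chains of balls joining the points of a John domain to a fixed ball, with geometrically
decreasing radii. -/
theorem IsJohnDomain.exists_chain (hΩ : IsJohnDomain Ω) (hb : (frontier Ω).Nonempty) {τ : ℝ}
    (hτ : τ ∈ Ioo (0 : ℝ) 1) :
    ∃ x₀ : X, ∃ T κ ρ L : ℝ, 0 < T ∧ 0 < κ ∧ ρ ∈ Ioo (0 : ℝ) 1 ∧ 0 < L ∧
      (∀ x ∈ Ω, bdryDist Ω x ≤ L) ∧
      ∀ x ∈ Ω, ∃ (N : ℕ) (y : ℕ → X), y 0 = x₀ ∧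
      (∀ j ≤ N, ball (y j) (κ * (T * ρ ^ j)) ⊆ Ω ∧
        ∀ w ∈ ball (y j) (κ * (T * ρ ^ j)), 2 * (κ * (T * ρ ^ j)) ≤ τ * bdryDist Ω w ∧
          T * ρ ^ j ≤ L * bdryDist Ω w ∧ dist w (y j) + bdryDist Ω w ≤ L * (κ * (T * ρ ^ j)) ∧
          dist x w ≤ L * bdryDist Ω w) ∧
      (∀ j < N, ball (y (j + 1)) (κ / 4 * (T * ρ ^ j)) ⊆
        ball (y j) (κ * (T * ρ ^ j)) ∩ ball (y (j + 1)) (κ * (T * ρ ^ (j + 1)))) ∧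
      T * ρ ^ N ≤ bdryDist Ω x ∧
      ∀ w ∈ ball (y N) (κ * (T * ρ ^ N)), dist w x ≤ τ * bdryDist Ω x ∧
        dist w x ≤ 2 * (T * ρ ^ N) := by
  obtain ⟨x₀, hx₀, c, T, hc, hT, h⟩ := hΩ.exists_curve hb
  obtain ⟨hτ0, hτ1⟩ := hτ
  have hc0 : 0 < c := by linarith
  have hd0 := bdryDist_pos hΩ.isOpen hb hx₀
  -- At time `t` the curve has a ball of radius `t / c` inside `Ω`, so `d ≥ t / (2c)` on the ball of
  -- radius `κ t`, and `2κt = τt / (4c)` is below `τ d` there.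
  obtain ⟨κ, hκ⟩ : ∃ κ, κ = τ / (8 * c) := ⟨_, rfl⟩
  have hκ0 : 0 < κ := by rw [hκ]; positivity
  have hκc : κ * c = τ / 8 := by rw [hκ]; field_simp
  have hκ8 : κ < 1 / 8 := by nlinarith
  -- Consecutive centers are then at most `κt / 2` apart, which leaves room for a common ball of
  -- radius `κt / 4`; `ρ > 1 / 2` keeps consecutive radii comparable.
  obtain ⟨ρ, hρ⟩ : ∃ ρ, ρ = 1 - κ / 2 := ⟨_, rfl⟩
  have hρ0 : 0 < ρ := by linarith
  have hρ1 : ρ < 1 := by linarith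
  have hρ2 : 1 / 2 < ρ := by linarith
  -- The chain stops once `t < c₁ d(x)`. The bound `τ / 2` puts the last ball within `τ d(x)` of
  -- `x`; the other entry gives `c₁ d(x) ≤ T`, so a stopping index exists.
  obtain ⟨c₁, hc₁⟩ : ∃ c₁, c₁ = min (τ / 2) (T / (bdryDist Ω x₀ + T)) := ⟨_, rfl⟩
  have hc₁0 : 0 < c₁ := by rw [hc₁]; positivity
  have hc₁τ : c₁ ≤ τ / 2 := by rw [hc₁]; exact min_le_left _ _
  have hc₁T : c₁ * (bdryDist Ω x₀ + T) ≤ T := by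
    rw [← le_div_iff₀ (by positivity), hc₁]
    exact min_le_right _ _
  have hbd : ∀ x ∈ Ω, bdryDist Ω x ≤ bdryDist Ω x₀ + T := by
    intro x hx
    obtain ⟨σ, h0, h1, hLip, -⟩ := h x hx
    have := hLip 0 ⟨le_rfl, hT.le⟩ T ⟨hT.le, le_rfl⟩
    rw [h0, h1, zero_sub, abs_neg, abs_of_pos hT] at this
    linarith [bdryDist_le_add (Ω := Ω) x x₀]
  -- The three entries serve, in order, the bound on `d` over `Ω`, the bounds of `t` and `dist x w`
  -- by `L * d(w)`, and the inclusion of `B(w, d(w))` in a multiple of the chain ball.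
  obtain ⟨L, hL⟩ : ∃ L, L = max (bdryDist Ω x₀ + T) (max (4 * c) ((2 / c₁ + 3) / κ)) := ⟨_, rfl⟩
  have hL1 : bdryDist Ω x₀ + T ≤ L := by rw [hL]; exact le_max_left _ _
  have hL2 : 4 * c ≤ L := by rw [hL]; exact (le_max_left _ _).trans (le_max_right _ _)
  have hL3 : 2 / c₁ + 3 ≤ L * κ := by
    rw [← div_le_iff₀ hκ0, hL]; exact (le_max_right _ _).trans (le_max_right _ _)
  have hL0 : 0 < L := by linarith
  refine ⟨x₀, T, κ, ρ, L, hT, hκ0, ⟨hρ0, hρ1⟩, hL0,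
    fun x hx => (hbd x hx).trans hL1, fun x hx => ?_⟩
  obtain ⟨σ, h0, h1, hLip, hball⟩ := h x hx
  have hdx := bdryDist_pos hΩ.isOpen hb hx
  have hcx : c₁ * bdryDist Ω x ≤ T := (by gcongr; exact hbd x hx : _ ≤ _).trans hc₁T
  obtain ⟨n, hn1, hn2⟩ := exists_nat_pow_near_of_lt_one (x := c₁ * bdryDist Ω x / T)
    (by positivity) ((div_le_one hT).2 hcx) hρ0 hρ1
  rw [lt_div_iff₀ hT] at hn1
  rw [div_le_iff₀ hT] at hn2
  have ht0 : ∀ j, 0 < T * ρ ^ j := fun j => by positivity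
  have htT : ∀ j, T * ρ ^ j ∈ Icc 0 T := fun j =>
    ⟨(ht0 j).le, mul_le_of_le_one_right hT.le (pow_le_one₀ hρ0.le hρ1.le)⟩
  have hdist : ∀ j, ∀ w ∈ ball (σ (T * ρ ^ j)) (κ * (T * ρ ^ j)), dist x w ≤ 2 * (T * ρ ^ j) := by
    intro j w hw
    have h2 := hLip 0 ⟨le_rfl, hT.le⟩ _ (htT j)
    rw [h0, zero_sub, abs_neg, abs_of_pos (ht0 j)] at h2
    have h3 := dist_triangle x (σ (T * ρ ^ j)) w
    rw [mem_ball, dist_comm] at hw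
    nlinarith [ht0 j]
  refine ⟨n + 1, fun j => σ (T * ρ ^ j), by simpa using h1, ?_, ?_, ?_, ?_⟩
  · intro j hj
    have ht := ht0 j
    have hκt : κ * (T * ρ ^ j) ≤ T * ρ ^ j / (2 * c) := by
      rw [le_div_iff₀ (by positivity)]
      nlinarith
    have hhalf : T * ρ ^ j / (2 * c) + T * ρ ^ j / (2 * c) = T * ρ ^ j / c := by field_simp; ring
    have hpos : 0 < T * ρ ^ j / (2 * c) := by positivity
    refine ⟨(ball_subset_ball (by linarith)).trans (hball _ (htT j)), fun w hw => ?_⟩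
    have hdw : T * ρ ^ j / (2 * c) ≤ bdryDist Ω w := by
      have h2 := le_bdryDist_of_ball_subset hΩ.isOpen hb (hball _ (htT j))
      have h3 := bdryDist_le_add (Ω := Ω) (σ (T * ρ ^ j)) w
      rw [mem_ball, dist_comm] at hw
      linarith
    have hdw' : 4 * (T * ρ ^ j / (2 * c)) * c = 2 * (T * ρ ^ j) := by field_simp; ring
    have hLd : 2 * (T * ρ ^ j) ≤ L * bdryDist Ω w := by
      calc 2 * (T * ρ ^ j) = 4 * c * (T * ρ ^ j / (2 * c)) := by rw [← hdw']; ring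
        _ ≤ L * bdryDist Ω w := by gcongr
    refine ⟨?_, by linarith, ?_, (hdist j w hw).trans hLd⟩
    · calc 2 * (κ * (T * ρ ^ j)) = (κ * c) * (4 * (T * ρ ^ j / (2 * c))) := by
            field_simp; ring
        _ = τ / 2 * (T * ρ ^ j / (2 * c)) := by rw [hκc]; ring
        _ ≤ τ * bdryDist Ω w := by gcongr; linarith
    -- The factor `2` covers the last index `n + 1`, one step past the threshold, using `ρ > 1 / 2`.
    · have h2 : c₁ * bdryDist Ω x ≤ 2 * (T * ρ ^ j) := by
        refine hn2.trans ?_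
        have : ρ ^ (n + 1) ≤ ρ ^ j := pow_le_pow_of_le_one hρ0.le hρ1.le hj
        rw [pow_succ] at this
        have hρn : 0 < ρ ^ n := by positivity
        nlinarith
      have h3 : bdryDist Ω x ≤ 2 / c₁ * (T * ρ ^ j) := by
        rw [div_mul_eq_mul_div, le_div_iff₀ hc₁0]
        linarith
      have h4 := bdryDist_le_add (Ω := Ω) w x
      have h5 := hdist j w hw
      rw [mem_ball] at hw
      rw [dist_comm] at h5
      calc _ ≤ (2 / c₁ + 3) * (T * ρ ^ j) := by nlinarith
        _ ≤ (L * κ) * (T * ρ ^ j) := by gcongr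
        _ = _ := by ring
  · intro j _
    have ht := ht0 j
    have h2 := hLip _ (htT (j + 1)) _ (htT j)
    have h3 : T * ρ ^ (j + 1) - T * ρ ^ j = -(κ / 2 * (T * ρ ^ j)) := by rw [pow_succ, hρ]; ring
    rw [h3, abs_neg, abs_of_pos (by positivity)] at h2
    refine subset_inter (ball_subset_ball' ?_) (ball_subset_ball ?_)
    · have : 0 < κ * (T * ρ ^ j) := by positivity
      linarith
    · calc κ / 4 * (T * ρ ^ j) ≤ κ * (T * ρ ^ j) * (1 / 2) := by
            have : 0 < κ * (T * ρ ^ j) := by positivity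
            linarith
        _ ≤ κ * (T * ρ ^ j) * ρ := by gcongr
        _ = _ := by rw [pow_succ]; ring
  · have : T * ρ ^ (n + 1) < c₁ * bdryDist Ω x := by linarith
    nlinarith
  · intro w hw
    have h2 := hdist _ w hw
    rw [dist_comm] at h2
    refine ⟨?_, h2⟩
    nlinarith

end John

/-! ### Energy density, local Poincaré inequality and telescoping. -/

section Energy

variable {X : Type*} [MetricSpace X] [MeasurableSpace X]

/-- The unweighted kernel of the fractional seminorm. -/
noncomputable def fracKernel (μ : Measure X) (s p : ℝ) (u : X → ℝ) (z y : X) : ℝ≥0∞ :=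
  ENNReal.ofReal (|u z - u y| ^ p) /
    (μ (ball z (dist z y)) * ENNReal.ofReal (dist z y ^ (s * p)))

/-- The energy density of the unweighted fractional seminorm. -/
noncomputable def fracEnergy (μ : Measure X) (Ω : Set X) (s τ p : ℝ) (u : X → ℝ) (y : X) : ℝ≥0∞ :=
  ∫⁻ z in Ω ∩ {z | dist z y ≤ τ * bdryDist Ω y}, fracKernel μ s p u z y ∂μ

variable {μ : Measure X} {Ω : Set X} {s τ p : ℝ} {u : X → ℝ}

theorem measurable_bdryDist [BorelSpace X] (Ω : Set X) : Measurable (bdryDist Ω) :=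
  (continuous_infDist_pt _).measurable

theorem measurable_fracKernel [BorelSpace X] [SecondCountableTopology X] [SFinite μ]
    (hu : Measurable u) : Measurable fun q : X × X => fracKernel μ s p u q.1 q.2 := by
  have hball : Measurable fun q : X × X => μ (ball q.1 (dist q.1 q.2)) := by
    have hS : MeasurableSet {w : (X × X) × X | dist w.2 w.1.1 < dist w.1.1 w.1.2} :=
      (isOpen_lt (by fun_prop) (by fun_prop)).measurableSet
    exact measurable_measure_prodMk_left hS
  have hdist : Measurable fun q : X × X => dist q.1 q.2 := measurable_fst.dist measurable_snd
  have hnum : Measurable fun q : X × X => |u q.1 - u q.2| :=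
    continuous_abs.measurable.comp ((hu.comp measurable_fst).sub (hu.comp measurable_snd))
  exact (hnum.pow_const p).ennreal_ofReal.div (hball.mul (hdist.pow_const _).ennreal_ofReal)

theorem measurable_fracEnergy [BorelSpace X] [SecondCountableTopology X] [SFinite μ]
    (hΩ : MeasurableSet Ω) (hu : Measurable u) : Measurable (fracEnergy μ Ω s τ p u) := by
  have hS : MeasurableSet {q : X × X | q.2 ∈ Ω ∧ dist q.2 q.1 ≤ τ * bdryDist Ω q.1} :=
    (measurable_snd hΩ).inter (measurableSet_le (measurable_snd.dist measurable_fst)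
      (((measurable_bdryDist Ω).comp measurable_fst).const_mul τ))
  have h := (((measurable_fracKernel (μ := μ) (s := s) (p := p) hu).comp
    measurable_swap).indicator hS).lintegral_prod_right' (ν := μ)
  convert h using 1
  ext y
  rw [fracEnergy, ← lintegral_indicator]
  · rfl
  · exact measurable_prodMk_left hS

/-- The denominator of the kernel increases with `dist z y`, so it may be replaced by its value at
`R`. On the diagonal the left side vanishes. -/
theorem ofReal_abs_sub_rpow_le_fracKernel (hμ : IsDoublingMeasure μ) (hp : 0 < p) (hs : 0 ≤ s)
    {z y : X} {R : ℝ} {M : ℝ≥0∞} (hzy : dist z y ≤ R) (hM : μ (ball z R) ≤ M) :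
    ENNReal.ofReal (|u z - u y| ^ p) ≤
      M * ENNReal.ofReal (R ^ (s * p)) * fracKernel μ s p u z y := by
  rcases eq_or_ne z y with rfl | hne
  · simp [hp.ne']
  have hd : 0 < dist z y := dist_pos.2 hne
  have h1 : μ (ball z (dist z y)) * ENNReal.ofReal (dist z y ^ (s * p)) ≠ 0 :=
    mul_ne_zero (hμ.ball_pos _ _ hd).ne'
      (ENNReal.ofReal_pos.2 (Real.rpow_pos_of_pos hd _)).ne'
  have h2 : μ (ball z (dist z y)) * ENNReal.ofReal (dist z y ^ (s * p)) ≠ ∞ :=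
    ENNReal.mul_ne_top (hμ.measure_ball_ne_top _ _) ENNReal.ofReal_ne_top
  calc ENNReal.ofReal (|u z - u y| ^ p)
      = μ (ball z (dist z y)) * ENNReal.ofReal (dist z y ^ (s * p)) * fracKernel μ s p u z y :=
        (ENNReal.mul_div_cancel h1 h2).symm
    _ ≤ _ := by
        gcongr
        exact (measure_mono (ball_subset_ball hzy)).trans hM

/-- Serves twice: with `y` a well-chosen point of a ball in the local Poincaré inequality, and with
`y` the endpoint `x` of a chain. -/
theorem setLIntegral_abs_sub_rpow_le_fracEnergy (hμ : IsDoublingMeasure μ) (hp : 0 < p)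
    (hs : 0 ≤ s) {y : X} {R : ℝ} {M : ℝ≥0∞} {B : Set X} (hB : MeasurableSet B) (hBΩ : B ⊆ Ω)
    (hM' : M ≠ ∞)
    (hBy : ∀ z ∈ B, dist z y ≤ τ * bdryDist Ω y ∧ dist z y ≤ R ∧ μ (ball z R) ≤ M) :
    ∫⁻ z in B, ENNReal.ofReal (|u z - u y| ^ p) ∂μ ≤
      M * ENNReal.ofReal (R ^ (s * p)) * fracEnergy μ Ω s τ p u y := by
  calc ∫⁻ z in B, ENNReal.ofReal (|u z - u y| ^ p) ∂μ
      ≤ ∫⁻ z in B, M * ENNReal.ofReal (R ^ (s * p)) * fracKernel μ s p u z y ∂μ :=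
        setLIntegral_mono' hB fun z hz =>
          ofReal_abs_sub_rpow_le_fracKernel hμ hp hs (hBy z hz).2.1 (hBy z hz).2.2
    _ = M * ENNReal.ofReal (R ^ (s * p)) * ∫⁻ z in B, fracKernel μ s p u z y ∂μ :=
        lintegral_const_mul' _ _ (ENNReal.mul_ne_top hM' ENNReal.ofReal_ne_top)
    _ ≤ _ := by
        gcongr
        exact lintegral_mono_set fun z hz => ⟨hBΩ hz, (hBy z hz).1⟩

/-- A local fractional Poincaré inequality on balls well inside `Ω`. -/
theorem exists_forall_setLIntegral_ball_le [BorelSpace X] [SecondCountableTopology X] [SFinite μ]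
    (hμ : IsDoublingMeasure μ) (hΩ : MeasurableSet Ω) (hp : 0 < p) (hs : 0 ≤ s) :
    ∃ C : ℝ≥0, ∀ u : X → ℝ, Measurable u → ∀ (y : X) (r : ℝ), 0 < r → ball y r ⊆ Ω →
      (∀ w ∈ ball y r, 2 * r ≤ τ * bdryDist Ω w) →
      ∃ a : ℝ, ∫⁻ z in ball y r, ENNReal.ofReal (|u z - a| ^ p) ∂μ ≤
        C * ENNReal.ofReal (r ^ (s * p)) * ∫⁻ w in ball y r, fracEnergy μ Ω s τ p u w ∂μ := by
  obtain ⟨C, hC⟩ := hμ.exists_measure_ball_le 3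
  refine ⟨C * Real.toNNReal (2 ^ (s * p)), fun u hu y r hr hsub hτ => ?_⟩
  have hpos := hμ.ball_pos y r hr
  have htop := hμ.measure_ball_ne_top y r
  -- Some `w` has energy at most the average. Taking `u w` instead of the mean of `u` as the
  -- constant avoids any integrability of `u`.
  obtain ⟨w, hw, hle⟩ := exists_le_setLAverage hpos.ne' htop
    (measurable_fracEnergy (μ := μ) (s := s) (τ := τ) (p := p) hΩ hu).aemeasurable
  refine ⟨u w, ?_⟩
  have h1 : ∀ z ∈ ball y r, dist z w ≤ 2 * r := fun z hz => by
    have := dist_triangle_right z w y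
    rw [mem_ball] at hz hw
    linarith
  have h2 := setLIntegral_abs_sub_rpow_le_fracEnergy (μ := μ) (Ω := Ω) (s := s) (τ := τ) (p := p)
    (u := u) hμ hp hs (R := 2 * r) (M := C * μ (ball y r)) measurableSet_ball hsub
    (ENNReal.mul_ne_top ENNReal.coe_ne_top htop) (y := w) fun z hz =>
      ⟨(h1 z hz).trans (hτ w hw), h1 z hz, hC _ _ _ _ hr (by rw [mem_ball] at hz; linarith)⟩
  refine h2.trans ?_
  have h3 : ENNReal.ofReal ((2 * r) ^ (s * p)) =
      ((2 ^ (s * p) : ℝ).toNNReal : ℝ≥0∞) * ENNReal.ofReal (r ^ (s * p)) := by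
    rw [Real.mul_rpow (by norm_num) hr.le, ENNReal.ofReal_mul (by positivity)]
    rfl
  rw [setLAverage_eq] at hle
  calc _ ≤ C * μ (ball y r) * ENNReal.ofReal ((2 * r) ^ (s * p)) *
          ((∫⁻ w in ball y r, fracEnergy μ Ω s τ p u w ∂μ) / μ (ball y r)) := by gcongr
    _ = C * ENNReal.ofReal ((2 * r) ^ (s * p)) * (μ (ball y r) *
          ((∫⁻ w in ball y r, fracEnergy μ Ω s τ p u w ∂μ) / μ (ball y r))) := by ring
    _ = _ := by
        rw [ENNReal.mul_div_cancel hpos.ne' htop, h3]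
        push_cast
        ring

theorem ofReal_abs_sub_rpow_le {p : ℝ} (hp : 1 ≤ p) (a b c : ℝ) :
    ENNReal.ofReal (|a - b| ^ p) ≤
      2 ^ p * (ENNReal.ofReal (|c - a| ^ p) + ENNReal.ofReal (|c - b| ^ p)) := by
  have hp0 : 0 ≤ p := by linarith
  simp only [← ENNReal.ofReal_rpow_of_nonneg (abs_nonneg _) hp0]
  calc ENNReal.ofReal |a - b| ^ p
      ≤ (ENNReal.ofReal |c - a| + ENNReal.ofReal |c - b|) ^ p := by
        gcongr
        rw [← ENNReal.ofReal_add (abs_nonneg _) (abs_nonneg _)]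
        refine ENNReal.ofReal_le_ofReal ?_
        rw [abs_sub_comm c a]
        exact abs_sub_le _ _ _
    _ ≤ 2 ^ (p - 1) * (ENNReal.ofReal |c - a| ^ p + ENNReal.ofReal |c - b| ^ p) :=
        ENNReal.rpow_add_le_mul_rpow_add_rpow _ _ hp
    _ ≤ _ := by
        gcongr
        · norm_num
        · linarith

/-- Both constants are compared with `u` on the common part `B` of the two sets. -/
theorem ofReal_abs_sub_rpow_mul_measure_le [BorelSpace X] (hp : 1 ≤ p) (hu : Measurable u) {a b : ℝ}
    {B B₁ B₂ : Set X} (h₁ : B ⊆ B₁) (h₂ : B ⊆ B₂) :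
    ENNReal.ofReal (|a - b| ^ p) * μ B ≤ 2 ^ p *
      (∫⁻ z in B₁, ENNReal.ofReal (|u z - a| ^ p) ∂μ +
        ∫⁻ z in B₂, ENNReal.ofReal (|u z - b| ^ p) ∂μ) := by
  have hp0 : 0 ≤ p := by linarith
  have hmeas : ∀ a : ℝ, Measurable fun z => ENNReal.ofReal (|u z - a| ^ p) := fun a =>
    ((continuous_abs.measurable.comp (hu.sub_const a)).pow_const p).ennreal_ofReal
  calc ENNReal.ofReal (|a - b| ^ p) * μ B = ∫⁻ _ in B, ENNReal.ofReal (|a - b| ^ p) ∂μ :=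
        (setLIntegral_const _ _).symm
    _ ≤ ∫⁻ z in B, 2 ^ p *
          (ENNReal.ofReal (|u z - a| ^ p) + ENNReal.ofReal (|u z - b| ^ p)) ∂μ :=
        lintegral_mono fun z => ofReal_abs_sub_rpow_le hp a b (u z)
    _ = 2 ^ p * (∫⁻ z in B, ENNReal.ofReal (|u z - a| ^ p) ∂μ +
          ∫⁻ z in B, ENNReal.ofReal (|u z - b| ^ p) ∂μ) := by
        rw [lintegral_const_mul' _ _ (ENNReal.rpow_ne_top_of_nonneg hp0 (by norm_num)),
          lintegral_add_left (hmeas a)]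
    _ ≤ _ := by
        gcongr

theorem ofReal_abs_sub_rpow_le_of_geometric {p θ : ℝ} (hp : 0 < p) (hθ : θ ∈ Ioo (0 : ℝ) 1)
    {A : ℝ≥0∞} {b : ℕ → ℝ} {N : ℕ}
    (h : ∀ j < N, ENNReal.ofReal (|b (j + 1) - b j| ^ p) ≤ A * ENNReal.ofReal ((θ ^ j) ^ p)) :
    ENNReal.ofReal (|b N - b 0| ^ p) ≤ A * ENNReal.ofReal ((1 / (1 - θ)) ^ p) := by
  obtain ⟨hθ0, hθ1⟩ := hθ
  have h1θ : 0 < 1 - θ := by linarith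
  -- In the application `A` contains the potential at a point, which may be infinite.
  rcases eq_or_ne A ∞ with rfl | hA
  · rw [ENNReal.top_mul]
    · exact le_top
    · exact (ENNReal.ofReal_pos.2 (by positivity)).ne'
  obtain ⟨α, hα0, rfl⟩ : ∃ α : ℝ, 0 ≤ α ∧ A = ENNReal.ofReal (α ^ p) := by
    refine ⟨A.toReal ^ p⁻¹, by positivity, ?_⟩
    rw [← Real.rpow_mul ENNReal.toReal_nonneg, inv_mul_cancel₀ hp.ne', Real.rpow_one,
      ENNReal.ofReal_toReal hA]
  have hstep : ∀ j < N, |b (j + 1) - b j| ≤ α * θ ^ j := by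
    intro j hj
    have h2 := h j hj
    rw [← ENNReal.ofReal_mul (by positivity), ← Real.mul_rpow hα0 (by positivity),
      ENNReal.ofReal_le_ofReal_iff (by positivity)] at h2
    exact (Real.rpow_le_rpow_iff (abs_nonneg _) (by positivity) hp).1 h2
  have hsum : ∀ n ≤ N, |b n - b 0| ≤ α * ((1 - θ ^ n) / (1 - θ)) := by
    intro n
    induction n with
    | zero => simp
    | succ n ih =>
      intro hn
      have h2 := ih (by omega)
      have h3 := hstep n (by omega)
      have h4 := abs_sub_le (b (n + 1)) (b n) (b 0)
      have h5 : α * ((1 - θ ^ (n + 1)) / (1 - θ)) =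
          α * θ ^ n + α * ((1 - θ ^ n) / (1 - θ)) := by
        field_simp
        ring
      linarith
  rw [← ENNReal.ofReal_mul (by positivity), ← Real.mul_rpow hα0 (by positivity)]
  refine ENNReal.ofReal_le_ofReal (Real.rpow_le_rpow (abs_nonneg _) ?_ hp.le)
  refine (hsum N le_rfl).trans ?_
  have : 0 < θ ^ N := by positivity
  gcongr
  linarith

end Energy

/-! ### Pointwise bound by energy and potential. -/

section Potential

variable {X : Type*} [MetricSpace X] [MeasurableSpace X]

/-- A Riesz-type potential of the energy density. -/
noncomputable def fracPotential (μ : Measure X) (Ω : Set X) (s τ p γ L : ℝ) (u : X → ℝ) (x : X) :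
    ℝ≥0∞ :=
  ∫⁻ w in {w | w ∈ Ω ∧ dist x w ≤ L * bdryDist Ω w},
    fracEnergy μ Ω s τ p u w * ENNReal.ofReal (bdryDist Ω w ^ (γ * p)) /
      μ (ball w (bdryDist Ω w)) ∂μ

variable {μ : Measure X} {Ω : Set X} {s τ p γ : ℝ}

/-- Of the factor `t^(sp)`, the part `t^(γp)` is absorbed into `d(w)^(γp)`; the rest, `t^((s-γ)p)`,
makes the sum along the chain converge. Doubling trades `μ(B(w, d(w)))` for the measure of the chain
ball. -/
theorem exists_mul_setLIntegral_fracEnergy_le_fracPotential [BorelSpace X]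
    (hμ : IsDoublingMeasure μ) (hΩ : IsOpen Ω) (hb : (frontier Ω).Nonempty) (hp : 0 < p)
    (hγ : 0 ≤ γ) {κ L : ℝ} (hκ : 0 < κ) (hL : 0 < L) :
    ∃ C : ℝ≥0, ∀ (u : X → ℝ) (x y : X) (t : ℝ), 0 < t → ball y (κ * t) ⊆ Ω →
      (∀ w ∈ ball y (κ * t), t ≤ L * bdryDist Ω w ∧ dist w y + bdryDist Ω w ≤ L * (κ * t) ∧
        dist x w ≤ L * bdryDist Ω w) →
      ENNReal.ofReal ((κ * t) ^ (s * p)) * ∫⁻ w in ball y (κ * t), fracEnergy μ Ω s τ p u w ∂μ ≤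
        C * ENNReal.ofReal (t ^ ((s - γ) * p)) * μ (ball y (κ * t)) *
          fracPotential μ Ω s τ p γ L u x := by
  obtain ⟨C, hC⟩ := hμ.exists_measure_ball_le L
  refine ⟨C * Real.toNNReal (κ ^ (s * p) * L ^ (γ * p)), fun u x y t ht hsub hw => ?_⟩
  have htop := hμ.measure_ball_ne_top y (κ * t)
  set M : ℝ≥0∞ := C * ENNReal.ofReal (κ ^ (s * p) * L ^ (γ * p)) *
    ENNReal.ofReal (t ^ ((s - γ) * p)) * μ (ball y (κ * t)) with hM
  have hMtop : M ≠ ∞ := by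
    refine ENNReal.mul_ne_top (ENNReal.mul_ne_top (ENNReal.mul_ne_top ?_ ?_) ?_) htop <;> simp
  have key : ∀ w ∈ ball y (κ * t), ENNReal.ofReal ((κ * t) ^ (s * p)) * fracEnergy μ Ω s τ p u w ≤
      M * (fracEnergy μ Ω s τ p u w * ENNReal.ofReal (bdryDist Ω w ^ (γ * p)) /
        μ (ball w (bdryDist Ω w))) := by
    intro w hwB
    obtain ⟨h1, h2, -⟩ := hw w hwB
    have hd := bdryDist_pos hΩ hb (hsub hwB)
    have h3 : (κ * t) ^ (s * p) ≤
        κ ^ (s * p) * L ^ (γ * p) * t ^ ((s - γ) * p) * bdryDist Ω w ^ (γ * p) := by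
      have h4 : t ^ (γ * p) ≤ L ^ (γ * p) * bdryDist Ω w ^ (γ * p) := by
        rw [← Real.mul_rpow hL.le hd.le]
        exact Real.rpow_le_rpow ht.le h1 (by positivity)
      have h5 : s * p = (s - γ) * p + γ * p := by ring
      calc (κ * t) ^ (s * p) = κ ^ (s * p) * (t ^ ((s - γ) * p) * t ^ (γ * p)) := by
            rw [Real.mul_rpow hκ.le ht.le, ← Real.rpow_add ht, ← h5]
        _ ≤ κ ^ (s * p) * (t ^ ((s - γ) * p) * (L ^ (γ * p) * bdryDist Ω w ^ (γ * p))) := by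
            gcongr
        _ = _ := by ring
    have h4 : μ (ball w (bdryDist Ω w)) ≤ C * μ (ball y (κ * t)) :=
      hC _ _ _ _ (by positivity) h2
    set E := fracEnergy μ Ω s τ p u w
    calc ENNReal.ofReal ((κ * t) ^ (s * p)) * E
        ≤ ENNReal.ofReal (κ ^ (s * p) * L ^ (γ * p) * t ^ ((s - γ) * p) *
            bdryDist Ω w ^ (γ * p)) * E := by gcongr
      _ = ENNReal.ofReal (κ ^ (s * p) * L ^ (γ * p)) * ENNReal.ofReal (t ^ ((s - γ) * p)) *
            (E * ENNReal.ofReal (bdryDist Ω w ^ (γ * p))) := by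
          rw [ENNReal.ofReal_mul (by positivity), ENNReal.ofReal_mul (by positivity)]
          ring
      _ = ENNReal.ofReal (κ ^ (s * p) * L ^ (γ * p)) * ENNReal.ofReal (t ^ ((s - γ) * p)) *
            (μ (ball w (bdryDist Ω w)) * (E * ENNReal.ofReal (bdryDist Ω w ^ (γ * p)) /
              μ (ball w (bdryDist Ω w)))) := by
          rw [ENNReal.mul_div_cancel (hμ.ball_pos _ _ hd).ne' (hμ.measure_ball_ne_top _ _)]
      _ ≤ ENNReal.ofReal (κ ^ (s * p) * L ^ (γ * p)) * ENNReal.ofReal (t ^ ((s - γ) * p)) *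
            (C * μ (ball y (κ * t)) * (E * ENNReal.ofReal (bdryDist Ω w ^ (γ * p)) /
              μ (ball w (bdryDist Ω w)))) := by gcongr
      _ = _ := by rw [hM]; ring
  calc _ = ∫⁻ w in ball y (κ * t), ENNReal.ofReal ((κ * t) ^ (s * p)) *
          fracEnergy μ Ω s τ p u w ∂μ := (lintegral_const_mul' _ _ ENNReal.ofReal_ne_top).symm
    _ ≤ ∫⁻ w in ball y (κ * t), M * (fracEnergy μ Ω s τ p u w *
          ENNReal.ofReal (bdryDist Ω w ^ (γ * p)) / μ (ball w (bdryDist Ω w))) ∂μ :=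
        setLIntegral_mono' measurableSet_ball key
    _ = M * ∫⁻ w in ball y (κ * t), fracEnergy μ Ω s τ p u w *
          ENNReal.ofReal (bdryDist Ω w ^ (γ * p)) / μ (ball w (bdryDist Ω w)) ∂μ :=
        lintegral_const_mul' _ _ hMtop
    _ ≤ M * fracPotential μ Ω s τ p γ L u x := by
        gcongr
        exact lintegral_mono_set fun w hwB => ⟨hsub hwB, (hw w hwB).2.2⟩
    _ = _ := by
        rw [hM, ENNReal.coe_mul]
        rfl

/-- On a John domain, the oscillation of a function is controlled pointwise by its fractional energy
density and the potential of that density. -/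
theorem IsJohnDomain.exists_pointwise_bound [BorelSpace X] (hμ : IsDoublingMeasure μ)
    (hΩ : IsJohnDomain Ω) (hb : (frontier Ω).Nonempty) (hp : 1 ≤ p) (hs : 0 ≤ s)
    (hτ : τ ∈ Ioo (0 : ℝ) 1) (hγ : 0 ≤ γ) (hγs : γ < s) :
    ∃ (C : ℝ≥0) (L : ℝ), 0 < L ∧ ∀ u : X → ℝ, Measurable u → ∃ a : ℝ, ∀ x ∈ Ω,
      ENNReal.ofReal (|u x - a| ^ p) ≤
        C * (ENNReal.ofReal (bdryDist Ω x ^ (γ * p)) * fracEnergy μ Ω s τ p u x +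
          fracPotential μ Ω s τ p γ L u x) := by
  have := hμ.sigmaFinite
  have := hμ.secondCountableTopology
  have hp0 : 0 < p := by linarith
  obtain ⟨x₀, T, κ, ρ, L, hT, hκ, ⟨hρ0, hρ1⟩, hL, hbd, hchain⟩ := hΩ.exists_chain hb hτ
  obtain ⟨C₁, hC₁⟩ := exists_forall_setLIntegral_ball_le (p := p) (s := s) (τ := τ) hμ
    hΩ.isOpen.measurableSet hp0 hs
  obtain ⟨C₂, hC₂⟩ := exists_mul_setLIntegral_fracEnergy_le_fracPotential (s := s) (τ := τ) hμ
    hΩ.isOpen hb hp0 hγ hκ hL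
  obtain ⟨C₃, hC₃⟩ := hμ.exists_measure_ball_le 8
  obtain ⟨C₄, hC₄⟩ := hμ.exists_measure_ball_le (1 + 2 / κ)
  obtain ⟨P, hP⟩ : ∃ P : ℝ≥0, (P : ℝ≥0∞) = 2 ^ p :=
    ⟨2 ^ p, by rw [ENNReal.coe_rpow_of_nonneg _ hp0.le]; rfl⟩
  obtain ⟨D, hD⟩ : ∃ D : ℝ≥0, (D : ℝ≥0∞) = ENNReal.ofReal (L ^ ((s - γ) * p)) := ⟨_, rfl⟩
  obtain ⟨Q, hQ⟩ : ∃ Q : ℝ≥0, (Q : ℝ≥0∞) = ENNReal.ofReal (T ^ ((s - γ) * p)) *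
    ENNReal.ofReal ((1 / (1 - ρ ^ (s - γ))) ^ p) := ⟨_, ENNReal.coe_mul _ _⟩
  obtain ⟨W, hW⟩ : ∃ W : ℝ≥0, (W : ℝ≥0∞) = C₄ * ENNReal.ofReal (2 ^ (s * p)) :=
    ⟨_, ENNReal.coe_mul _ _⟩
  refine ⟨P * (P * (W * D + C₁ * C₂ * D) + P * (2 * (C₁ * C₂ * C₃)) * Q), L, hL, fun u hu => ?_⟩
  have hex : ∀ (y : X) (r : ℝ), ∃ a : ℝ,
      (0 < r ∧ ball y r ⊆ Ω ∧ ∀ w ∈ ball y r, 2 * r ≤ τ * bdryDist Ω w) →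
      ∫⁻ z in ball y r, ENNReal.ofReal (|u z - a| ^ p) ∂μ ≤
        C₁ * ENNReal.ofReal (r ^ (s * p)) * ∫⁻ w in ball y r, fracEnergy μ Ω s τ p u w ∂μ := by
    intro y r
    by_cases h : 0 < r ∧ ball y r ⊆ Ω ∧ ∀ w ∈ ball y r, 2 * r ≤ τ * bdryDist Ω w
    · obtain ⟨a, ha⟩ := hC₁ u hu y r h.1 h.2.1 h.2.2
      exact ⟨a, fun _ => ha⟩
    · exact ⟨0, fun h' => absurd h' h⟩
  -- The constant is chosen as a function of the ball alone. All chains start at the same ball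
  -- around `x₀`, so the resulting `a` does not depend on `x`.
  choose A hA using hex
  refine ⟨A x₀ (κ * (T * ρ ^ 0)), fun x hx => ?_⟩
  obtain ⟨N, y, hy0, hB, hlink, hN1, hN2⟩ := hchain x hx
  have ht : ∀ j, 0 < T * ρ ^ j := fun j => by positivity
  have hr : ∀ j, 0 < κ * (T * ρ ^ j) := fun j => by positivity
  set H := fracPotential μ Ω s τ p γ L u x with hH
  have hosc : ∀ j ≤ N, ∫⁻ z in ball (y j) (κ * (T * ρ ^ j)),
      ENNReal.ofReal (|u z - A (y j) (κ * (T * ρ ^ j))| ^ p) ∂μ ≤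
      C₁ * C₂ * ENNReal.ofReal ((T * ρ ^ j) ^ ((s - γ) * p)) *
        μ (ball (y j) (κ * (T * ρ ^ j))) * H := by
    intro j hj
    obtain ⟨hsub, hw⟩ := hB j hj
    refine (hA _ _ ⟨hr j, hsub, fun w hwB => (hw w hwB).1⟩).trans ?_
    rw [mul_assoc]
    refine (mul_le_mul_right (hC₂ u x (y j) _ (ht j) hsub fun w hwB => (hw w hwB).2) _).trans ?_
    exact le_of_eq (by ring)
  have hstep : ∀ j < N, ENNReal.ofReal (|A (y (j + 1)) (κ * (T * ρ ^ (j + 1))) -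
      A (y j) (κ * (T * ρ ^ j))| ^ p) ≤ P * (2 * (C₁ * C₂ * C₃)) *
        ENNReal.ofReal (T ^ ((s - γ) * p)) * H * ENNReal.ofReal (((ρ ^ (s - γ)) ^ j) ^ p) := by
    intro j hj
    have hsub := hlink j hj
    have hr' : 0 < κ / 4 * (T * ρ ^ j) := by positivity
    have hle : T * ρ ^ (j + 1) ≤ T * ρ ^ j := by
      rw [pow_succ, ← mul_assoc]
      exact mul_le_of_le_one_right (ht j).le hρ1.le
    have h1 : μ (ball (y j) (κ * (T * ρ ^ j))) ≤ C₃ * μ (ball (y (j + 1)) (κ / 4 * (T * ρ ^ j))) := by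
      refine hC₃ _ _ _ _ hr' ?_
      have := (hsub (mem_ball_self hr')).1
      rw [mem_ball, dist_comm] at this
      linarith
    have h2 : μ (ball (y (j + 1)) (κ * (T * ρ ^ (j + 1)))) ≤
        C₃ * μ (ball (y (j + 1)) (κ / 4 * (T * ρ ^ j))) := by
      refine hC₃ _ _ _ _ hr' ?_
      rw [dist_self]
      nlinarith [hr j]
    have h3 : ENNReal.ofReal ((T * ρ ^ (j + 1)) ^ ((s - γ) * p)) ≤
        ENNReal.ofReal ((T * ρ ^ j) ^ ((s - γ) * p)) :=
      ENNReal.ofReal_le_ofReal (Real.rpow_le_rpow (ht _).le hle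
        (mul_nonneg (by linarith) hp0.le))
    have h4 : ENNReal.ofReal ((T * ρ ^ j) ^ ((s - γ) * p)) = ENNReal.ofReal (T ^ ((s - γ) * p)) *
        ENNReal.ofReal (((ρ ^ (s - γ)) ^ j) ^ p) := by
      rw [Real.mul_rpow hT.le (by positivity), ENNReal.ofReal_mul (by positivity),
        Real.rpow_mul (by positivity : 0 ≤ ρ ^ j), Real.rpow_pow_comm hρ0.le]
    have h5 := ofReal_abs_sub_rpow_mul_measure_le (μ := μ) hp hu
      (a := A (y (j + 1)) (κ * (T * ρ ^ (j + 1)))) (b := A (y j) (κ * (T * ρ ^ j)))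
      (fun z hz => (hsub hz).2) (fun z hz => (hsub hz).1)
    -- Multiply by the measure of the linking ball, which is comparable to both chain balls, and
    -- cancel it at the end.
    refine (ENNReal.mul_le_mul_iff_left (hμ.ball_pos _ _ hr').ne'
      (hμ.measure_ball_ne_top _ _)).1 (h5.trans ?_)
    calc _ ≤ 2 ^ p * (C₁ * C₂ * ENNReal.ofReal ((T * ρ ^ j) ^ ((s - γ) * p)) *
              (C₃ * μ (ball (y (j + 1)) (κ / 4 * (T * ρ ^ j)))) * H +
            C₁ * C₂ * ENNReal.ofReal ((T * ρ ^ j) ^ ((s - γ) * p)) *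
              (C₃ * μ (ball (y (j + 1)) (κ / 4 * (T * ρ ^ j)))) * H) := by
          gcongr
          · refine (hosc (j + 1) hj).trans ?_
            gcongr
          · refine (hosc j hj.le).trans ?_
            gcongr
      _ = _ := by
          rw [h4, hP]
          ring
  have hsum := ofReal_abs_sub_rpow_le_of_geometric hp0
    (b := fun j => A (y j) (κ * (T * ρ ^ j))) (θ := ρ ^ (s - γ))
    ⟨by positivity, Real.rpow_lt_one hρ0.le hρ1 (by linarith)⟩ hstep
  have hnear : ENNReal.ofReal (|u x - A (y N) (κ * (T * ρ ^ N))| ^ p) ≤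
      P * (W * ENNReal.ofReal ((T * ρ ^ N) ^ (s * p)) * fracEnergy μ Ω s τ p u x +
        C₁ * C₂ * ENNReal.ofReal ((T * ρ ^ N) ^ ((s - γ) * p)) * H) := by
    have h1 := setLIntegral_abs_sub_rpow_le_fracEnergy (u := u) (s := s) (p := p) (τ := τ) hμ hp0 hs
      (y := x) (R := 2 * (T * ρ ^ N)) (M := C₄ * μ (ball (y N) (κ * (T * ρ ^ N))))
      measurableSet_ball (hB N le_rfl).1
      (ENNReal.mul_ne_top ENNReal.coe_ne_top (hμ.measure_ball_ne_top _ _)) fun z hz =>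
        ⟨(hN2 z hz).1, (hN2 z hz).2, hC₄ _ _ _ _ (hr N) (by
          rw [mem_ball] at hz
          have : (1 + 2 / κ) * (κ * (T * ρ ^ N)) = κ * (T * ρ ^ N) + 2 * (T * ρ ^ N) := by
            field_simp
          linarith)⟩
    have h2 := ofReal_abs_sub_rpow_mul_measure_le (μ := μ) hp hu
      (a := u x) (b := A (y N) (κ * (T * ρ ^ N))) (Subset.refl (ball (y N) (κ * (T * ρ ^ N))))
      (Subset.refl _)
    refine (ENNReal.mul_le_mul_iff_left (hμ.ball_pos _ _ (hr N)).ne'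
      (hμ.measure_ball_ne_top _ _)).1 (h2.trans ?_)
    calc _ ≤ 2 ^ p * (C₄ * μ (ball (y N) (κ * (T * ρ ^ N))) *
            ENNReal.ofReal ((2 * (T * ρ ^ N)) ^ (s * p)) * fracEnergy μ Ω s τ p u x +
          C₁ * C₂ * ENNReal.ofReal ((T * ρ ^ N) ^ ((s - γ) * p)) *
            μ (ball (y N) (κ * (T * ρ ^ N))) * H) := by
          gcongr
          exact hosc N le_rfl
      _ = _ := by
          rw [Real.mul_rpow (by norm_num) (ht N).le, ENNReal.ofReal_mul (by positivity), hW, hP]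
          ring
  have hdx := bdryDist_pos hΩ.isOpen hb hx
  -- The last scale satisfies `T * ρ ^ N ≤ d(x) ≤ L`: spare positive powers of it become constants,
  -- and the power `γ * p` becomes `d(x)^(γp)`.
  have hg1 : ENNReal.ofReal ((T * ρ ^ N) ^ ((s - γ) * p)) ≤ D := by
    rw [hD]
    exact ENNReal.ofReal_le_ofReal (Real.rpow_le_rpow (ht N).le (hN1.trans (hbd x hx))
      (mul_nonneg (by linarith) hp0.le))
  have hg2 : ENNReal.ofReal ((T * ρ ^ N) ^ (s * p)) ≤
      D * ENNReal.ofReal (bdryDist Ω x ^ (γ * p)) := by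
    have h1 : s * p = (s - γ) * p + γ * p := by ring
    rw [h1, Real.rpow_add (ht N), ENNReal.ofReal_mul (by have := ht N; positivity)]
    gcongr
  have htri := ofReal_abs_sub_rpow_le hp (u x) (A x₀ (κ * (T * ρ ^ 0)))
    (A (y N) (κ * (T * ρ ^ N)))
  rw [abs_sub_comm _ (u x)] at htri
  simp only [hy0] at hsum
  set E := fracEnergy μ Ω s τ p u x
  set V := ENNReal.ofReal (bdryDist Ω x ^ (γ * p))
  calc _ ≤ _ := htri
    _ ≤ 2 ^ p * (P * (W * (D * V) * E + C₁ * C₂ * D * H) +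
          P * (2 * (C₁ * C₂ * C₃)) * ENNReal.ofReal (T ^ ((s - γ) * p)) * H *
            ENNReal.ofReal ((1 / (1 - ρ ^ (s - γ))) ^ p)) := by
        gcongr
        refine hnear.trans ?_
        gcongr
    _ = P * (P * (W * D * (V * E) + C₁ * C₂ * D * H) + P * (2 * (C₁ * C₂ * C₃)) * Q * H) := by
        rw [hQ, hP]
        ring
    _ ≤ P * (P * (W * D * (V * E + H) + C₁ * C₂ * D * (V * E + H)) +
          P * (2 * (C₁ * C₂ * C₃)) * Q * (V * E + H)) := by
        gcongr
        · exact le_self_add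
        · exact le_add_self
        · exact le_add_self
    _ = _ := by
        push_cast
        ring

end Potential

/-! ### Integration against the weight. -/

section Weighted

variable {X : Type*} [MetricSpace X] [MeasurableSpace X] {μ : Measure X} {Ω : Set X} {s τ p γ : ℝ}

/-- By Tonelli: for fixed `w` the points `x` with `dist x w ≤ L * d(w)` lie in a multiple of `B(w,
d(w))`, so doubling cancels the denominator of the potential, while `hΦK` moves the weight from `x`
to `w`. -/
theorem exists_setLIntegral_mul_fracPotential_le [BorelSpace X] (hμ : IsDoublingMeasure μ)
    (hΩ : IsOpen Ω) (hb : (frontier Ω).Nonempty) {L : ℝ} {K : ℝ≥0} {Φ : X → ℝ≥0∞}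
    (hΦ : Measurable Φ)
    (hΦK : ∀ x ∈ Ω, ∀ w ∈ Ω, dist x w ≤ L * bdryDist Ω w → Φ x ≤ K * Φ w) :
    ∃ C : ℝ≥0, ∀ u : X → ℝ, Measurable u →
      ∫⁻ x in Ω, Φ x * fracPotential μ Ω s τ p γ L u x ∂μ ≤
        C * ∫⁻ w in Ω, Φ w * (ENNReal.ofReal (bdryDist Ω w ^ (γ * p)) *
          fracEnergy μ Ω s τ p u w) ∂μ := by
  have := hμ.sigmaFinite
  have := hμ.secondCountableTopology
  obtain ⟨C, hC⟩ := hμ.exists_measure_ball_le (L + 1)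
  refine ⟨K * C, fun u hu => ?_⟩
  have hE := measurable_fracEnergy (μ := μ) (s := s) (τ := τ) (p := p) hΩ.measurableSet hu
  have hd := measurable_bdryDist Ω
  set E := fracEnergy μ Ω s τ p u
  set V : X → ℝ≥0∞ := fun w => ENNReal.ofReal (bdryDist Ω w ^ (γ * p)) with hV
  have hVm : Measurable V := (hd.pow_const _).ennreal_ofReal
  set m : X → ℝ≥0∞ := fun w => μ (ball w (bdryDist Ω w)) with hm
  have hmm : Measurable m := by
    have hS : MeasurableSet {q : X × X | dist q.2 q.1 < bdryDist Ω q.1} :=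
      measurableSet_lt (measurable_snd.dist measurable_fst) (hd.comp measurable_fst)
    exact measurable_measure_prodMk_left hS
  set h : X → ℝ≥0∞ := fun w => E w * V w / m w with hh
  have hhm : Measurable h := (hE.mul hVm).div hmm
  have hS : MeasurableSet {q : X × X | dist q.1 q.2 ≤ L * bdryDist Ω q.2} :=
    measurableSet_le (measurable_fst.dist measurable_snd) ((hd.comp measurable_snd).const_mul L)
  have hSw : ∀ w, MeasurableSet {x | dist x w ≤ L * bdryDist Ω w} := fun w =>
    measurable_prodMk_right hS
  have hFm : Measurable ({q : X × X | dist q.1 q.2 ≤ L * bdryDist Ω q.2}.indicator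
      fun q => Φ q.1 * h q.2) :=
    ((hΦ.comp measurable_fst).mul (hhm.comp measurable_snd)).indicator hS
  calc ∫⁻ x in Ω, Φ x * fracPotential μ Ω s τ p γ L u x ∂μ
      = ∫⁻ x in Ω, ∫⁻ w in Ω, {q : X × X | dist q.1 q.2 ≤ L * bdryDist Ω q.2}.indicator
          (fun q => Φ q.1 * h q.2) (x, w) ∂μ ∂μ := by
        refine lintegral_congr fun x => ?_
        have hSx : MeasurableSet {w | dist x w ≤ L * bdryDist Ω w} := measurable_prodMk_left hS
        have h1 : fracPotential μ Ω s τ p γ L u x =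
            ∫⁻ w in {w | dist x w ≤ L * bdryDist Ω w}, h w ∂(μ.restrict Ω) := by
          rw [Measure.restrict_restrict hSx, inter_comm]
          rfl
        rw [h1, ← lintegral_const_mul _ hhm, ← lintegral_indicator hSx]
        rfl
    _ = ∫⁻ w in Ω, ∫⁻ x in Ω, {q : X × X | dist q.1 q.2 ≤ L * bdryDist Ω q.2}.indicator
          (fun q => Φ q.1 * h q.2) (x, w) ∂μ ∂μ := lintegral_lintegral_swap hFm.aemeasurable
    _ ≤ ∫⁻ w in Ω, (K * C : ℝ≥0) * (Φ w * (V w * E w)) ∂μ := by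
        refine setLIntegral_mono' hΩ.measurableSet fun w hw => ?_
        have hdw := bdryDist_pos hΩ hb hw
        calc ∫⁻ x in Ω, {q : X × X | dist q.1 q.2 ≤ L * bdryDist Ω q.2}.indicator
              (fun q => Φ q.1 * h q.2) (x, w) ∂μ
            ≤ ∫⁻ x in Ω, {x | dist x w ≤ L * bdryDist Ω w}.indicator
                (fun _ => K * Φ w * h w) x ∂μ := by
              refine setLIntegral_mono' hΩ.measurableSet fun x hx => ?_
              by_cases hxw : dist x w ≤ L * bdryDist Ω w
              · simp only [indicator, mem_ofPred_eq, hxw, if_true]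
                gcongr
                exact hΦK x hx w hw hxw
              · simp [indicator, hxw]
          _ = K * Φ w * h w * μ ({x | dist x w ≤ L * bdryDist Ω w} ∩ Ω) := by
              rw [lintegral_indicator_const (hSw w), Measure.restrict_apply (hSw w)]
          _ ≤ K * Φ w * h w * (C * m w) := by
              gcongr
              refine (measure_mono ?_).trans
                (hC w w _ ((L + 1) * bdryDist Ω w) hdw (by simp))
              rintro x ⟨hx, -⟩
              rw [mem_ofPred_eq] at hx
              rw [mem_ball]
              linarith
          _ = K * C * Φ w * (m w * (E w * V w / m w)) := by ring
          _ = _ := by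
              rw [ENNReal.mul_div_cancel (hμ.ball_pos _ _ hdw).ne' (hμ.measure_ball_ne_top _ _)]
              push_cast
              ring
    _ = _ := lintegral_const_mul' _ _ ENNReal.coe_ne_top

/-- The weighted Poincaré inequality for measurable functions, in terms of the energy density. -/
theorem IsJohnDomain.exists_setLIntegral_le [BorelSpace X] (hμ : IsDoublingMeasure μ)
    (hΩ : IsJohnDomain Ω) (hb : (frontier Ω).Nonempty) (hp : 1 ≤ p) (hs : 0 ≤ s)
    (hτ : τ ∈ Ioo (0 : ℝ) 1) (hγ : 0 ≤ γ) (hγs : γ < s) {Φ : X → ℝ≥0∞} (hΦ : Measurable Φ)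
    (hΦK : ∀ L : ℝ, ∃ K : ℝ≥0, ∀ x ∈ Ω, ∀ w ∈ Ω, dist x w ≤ L * bdryDist Ω w → Φ x ≤ K * Φ w) :
    ∃ C : ℝ≥0, ∀ u : X → ℝ, Measurable u → ∃ a : ℝ,
      ∫⁻ x in Ω, Φ x * ENNReal.ofReal (|u x - a| ^ p) ∂μ ≤
        C * ∫⁻ w in Ω, Φ w * (ENNReal.ofReal (bdryDist Ω w ^ (γ * p)) *
          fracEnergy μ Ω s τ p u w) ∂μ := by
  have := hμ.sigmaFinite
  have := hμ.secondCountableTopology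
  obtain ⟨C₁, L, -, h₁⟩ := hΩ.exists_pointwise_bound hμ hb hp hs hτ hγ hγs
  obtain ⟨K, hK⟩ := hΦK L
  obtain ⟨C₂, h₂⟩ := exists_setLIntegral_mul_fracPotential_le (s := s) (τ := τ) (p := p) (γ := γ)
    hμ hΩ.isOpen hb hΦ hK
  refine ⟨C₁ * (1 + C₂), fun u hu => ?_⟩
  obtain ⟨a, ha⟩ := h₁ u hu
  refine ⟨a, ?_⟩
  have hE := measurable_fracEnergy (μ := μ) (s := s) (τ := τ) (p := p) hΩ.isOpen.measurableSet hu
  have hm : Measurable fun x => Φ x * (ENNReal.ofReal (bdryDist Ω x ^ (γ * p)) *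
      fracEnergy μ Ω s τ p u x) :=
    hΦ.mul ((((measurable_bdryDist Ω).pow_const _).ennreal_ofReal).mul hE)
  calc ∫⁻ x in Ω, Φ x * ENNReal.ofReal (|u x - a| ^ p) ∂μ
      ≤ ∫⁻ x in Ω, C₁ * (Φ x * (ENNReal.ofReal (bdryDist Ω x ^ (γ * p)) *
          fracEnergy μ Ω s τ p u x) + Φ x * fracPotential μ Ω s τ p γ L u x) ∂μ := by
        refine setLIntegral_mono' hΩ.isOpen.measurableSet fun x hx => ?_
        calc _ ≤ Φ x * (C₁ * (ENNReal.ofReal (bdryDist Ω x ^ (γ * p)) *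
              fracEnergy μ Ω s τ p u x + fracPotential μ Ω s τ p γ L u x)) := by
              gcongr
              exact ha x hx
          _ = _ := by ring
    _ ≤ _ := by
        rw [lintegral_const_mul' _ _ ENNReal.coe_ne_top, lintegral_add_left hm]
        push_cast
        rw [mul_assoc, add_mul, one_mul]
        gcongr
        exact h₂ u hu

/-- The weighted energy is controlled by the double integral in the fractional seminorm. -/
theorem exists_setLIntegral_mul_fracEnergy_le (hΩ : IsOpen Ω) (hb : (frontier Ω).Nonempty)
    (hτ : τ ∈ Ioo (0 : ℝ) 1) (hp : 0 ≤ p) (hγ : 0 ≤ γ) [OpensMeasurableSpace X] {φ : ℝ → ℝ}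
    (hφpos : ∀ t, 0 < t → 0 < φ t)
    (hφ : ∀ L : ℝ, ∃ C : ℝ≥0, ∀ a b : ℝ, 0 < a → 0 < b → a ≤ L * b → φ a ≤ C * φ b) :
    ∃ C : ℝ≥0, ∀ u : X → ℝ,
      ∫⁻ y in Ω, ENNReal.ofReal (φ (bdryDist Ω y)) * (ENNReal.ofReal (bdryDist Ω y ^ (γ * p)) *
          fracEnergy μ Ω s τ p u y) ∂μ ≤
        C * ∫⁻ y in Ω, ∫⁻ z in Ω ∩ {z | dist z y ≤ τ * bdryDist Ω y},
          ENNReal.ofReal (|u z - u y| ^ p * vWeight Ω φ (γ * p) z y) /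
            (μ (ball z (dist z y)) * ENNReal.ofReal (dist z y ^ (s * p))) ∂μ ∂μ := by
  obtain ⟨hτ0, hτ1⟩ := hτ
  have h1τ : 0 < 1 - τ := by linarith
  -- From `d(z, y) ≤ τ d(y)` follows `(1 - τ) d(y) ≤ d(z)`.
  obtain ⟨L, hL⟩ : ∃ L, L = 1 / (1 - τ) := ⟨_, rfl⟩
  have hL1 : 1 ≤ L := by rw [hL, le_div_iff₀ h1τ]; linarith
  have hLτ : L * (1 - τ) = 1 := by rw [hL]; field_simp
  obtain ⟨K, hK⟩ := hφ L
  refine ⟨Real.toNNReal (L ^ (γ * p) * K), fun u => ?_⟩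
  rw [← lintegral_const_mul' _ _ ENNReal.coe_ne_top]
  refine setLIntegral_mono' hΩ.measurableSet fun y hy => ?_
  have hdy := bdryDist_pos hΩ hb hy
  have hS : MeasurableSet (Ω ∩ {z | dist z y ≤ τ * bdryDist Ω y}) :=
    hΩ.measurableSet.inter (isClosed_le (by fun_prop) continuous_const).measurableSet
  rw [← mul_assoc, fracEnergy, ← lintegral_const_mul' _ _ ENNReal.coe_ne_top,
    ← lintegral_const_mul' _ _ (ENNReal.mul_ne_top ENNReal.ofReal_ne_top ENNReal.ofReal_ne_top)]
  refine setLIntegral_mono' hS fun z ⟨hz, hzy⟩ => ?_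
  rw [mem_ofPred_eq] at hzy
  have hdz := bdryDist_pos hΩ hb hz
  have hyz : bdryDist Ω y ≤ L * bdryDist Ω z := by
    have h1 := bdryDist_le_add (Ω := Ω) y z
    rw [dist_comm] at h1
    calc bdryDist Ω y = L * ((1 - τ) * bdryDist Ω y) := by rw [← mul_assoc, hLτ, one_mul]
      _ ≤ L * bdryDist Ω z := by gcongr; linarith
  have key : ∀ w ∈ Ω, bdryDist Ω y ≤ L * bdryDist Ω w →
      φ (bdryDist Ω y) * bdryDist Ω y ^ (γ * p) ≤
        L ^ (γ * p) * K * (bdryDist Ω w ^ (γ * p) * φ (bdryDist Ω w)) := by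
    intro w hw hyw
    have hdw := bdryDist_pos hΩ hb hw
    have h1 := hK _ _ hdy hdw hyw
    have h2 : bdryDist Ω y ^ (γ * p) ≤ L ^ (γ * p) * bdryDist Ω w ^ (γ * p) := by
      rw [← Real.mul_rpow (by linarith) hdw.le]
      exact Real.rpow_le_rpow hdy.le hyw (by positivity)
    have h3 := hφpos _ hdw
    calc _ ≤ (K * φ (bdryDist Ω w)) * (L ^ (γ * p) * bdryDist Ω w ^ (γ * p)) := by gcongr
      _ = _ := by ring
  have hv : φ (bdryDist Ω y) * bdryDist Ω y ^ (γ * p) ≤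
      L ^ (γ * p) * K * vWeight Ω φ (γ * p) z y := by
    rw [vWeight, mul_min_of_nonneg _ _ (by positivity)]
    exact le_min (key z hz hyz) (key y hy (by nlinarith))
  have hφy := hφpos _ hdy
  rw [fracKernel, ENNReal.ofReal_mul (by positivity : 0 ≤ |u z - u y| ^ p),
    ← ENNReal.ofReal_mul hφy.le]
  calc _ ≤ ENNReal.ofReal (L ^ (γ * p) * K * vWeight Ω φ (γ * p) z y) *
        (ENNReal.ofReal (|u z - u y| ^ p) /
          (μ (ball z (dist z y)) * ENNReal.ofReal (dist z y ^ (s * p)))) := by gcongr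
    _ = ENNReal.ofReal (L ^ (γ * p) * K) * (ENNReal.ofReal (|u z - u y| ^ p) *
        ENNReal.ofReal (vWeight Ω φ (γ * p) z y) /
          (μ (ball z (dist z y)) * ENNReal.ofReal (dist z y ^ (s * p)))) := by
        rw [ENNReal.ofReal_mul (by positivity), div_eq_mul_inv, div_eq_mul_inv]
        ring
    _ = _ := rfl

end Weighted

/-! ### Assembly of the improved inequality. -/

theorem mainTheorem5 {X : Type*} [MetricSpace X] [CompleteSpace X] [MeasurableSpace X]
    [BorelSpace X] (μ : Measure X) (hμ : IsDoublingMeasure μ)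
    (Ω : Set X) (hΩ : IsJohnDomain Ω) (hbdry : (frontier Ω).Nonempty)
    (p s τ γ : ℝ) (hp : 1 ≤ p) (hs : s ∈ Ioo (0 : ℝ) 1) (hτ : τ ∈ Ioo (0 : ℝ) 1)
    (hγ : 0 ≤ γ) (hγs : γ < s)
    (φ : ℝ → ℝ) (hφpos : ∀ t, 0 < t → 0 < φ t) (hφmono : MonotoneOn φ (Ioi 0))
    (hφdbl : ∃ K : ℝ, ∀ t, 0 < t → φ (2 * t) ≤ K * φ t) :
    SupportsFracPoincare μ Ω s τ p p (wWeight Ω φ) (vWeight Ω φ (γ * p)) := by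
  have hp0 : 0 < p := by linarith
  have hφ := hφmono.exists_le_mul_of_doubling hφpos hφdbl
  have hpos : ∀ x ∈ Ω, 0 < bdryDist Ω x := fun x hx => bdryDist_pos hΩ.isOpen hbdry hx
  -- Nothing is known about `φ` on `(-∞, 0]`. Extending it by zero there gives a globally monotone,
  -- hence Borel, function and leaves the weight on `Ω` unchanged.
  set Φ : X → ℝ≥0∞ := fun x => ENNReal.ofReal ((Ioi 0).indicator φ (bdryDist Ω x)) with hΦdef
  have hΦeq : ∀ x ∈ Ω, Φ x = ENNReal.ofReal (φ (bdryDist Ω x)) := fun x hx => by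
    simp only [hΦdef]
    rw [indicator_of_mem (mem_Ioi.2 (hpos x hx))]
  have hΦm : Measurable Φ := by
    have hmono : Monotone ((Ioi 0).indicator φ) := by
      intro a b hab
      rcases le_or_gt a 0 with ha | ha
      · rw [indicator_of_notMem (by simpa using ha)]
        exact indicator_nonneg (fun t ht => (hφpos t ht).le) b
      · rw [indicator_of_mem (mem_Ioi.2 ha), indicator_of_mem (mem_Ioi.2 (ha.trans_le hab))]
        exact hφmono ha (ha.trans_le hab) hab
    exact (hmono.measurable.comp (measurable_bdryDist Ω)).ennreal_ofReal
  have hΦK : ∀ L : ℝ, ∃ K : ℝ≥0, ∀ x ∈ Ω, ∀ w ∈ Ω, dist x w ≤ L * bdryDist Ω w →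
      Φ x ≤ K * Φ w := by
    intro L
    obtain ⟨K, hK⟩ := hφ (L + 1)
    refine ⟨K, fun x hx w hw hxw => ?_⟩
    rw [hΦeq x hx, hΦeq w hw, ← ENNReal.ofReal_coe_nnreal, ← ENNReal.ofReal_mul K.coe_nonneg]
    refine ENNReal.ofReal_le_ofReal (hK _ _ (hpos x hx) (hpos w hw) ?_)
    linarith [bdryDist_le_add (Ω := Ω) x w]
  obtain ⟨C₁, h₁⟩ := hΩ.exists_setLIntegral_le hμ hbdry hp hs.1.le hτ hγ hγs hΦm hΦK
  obtain ⟨C₂, h₂⟩ := exists_setLIntegral_mul_fracEnergy_le (μ := μ) (s := s) hΩ.isOpen hbdry hτ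
    hp0.le hγ hφpos hφ
  have hΩm := hΩ.isOpen.measurableSet
  have hwm : weightedMeasure μ Ω (wWeight Ω φ) = (μ.restrict Ω).withDensity Φ :=
    withDensity_congr_ae <| (ae_restrict_mem hΩm).mono fun x hx => (hΦeq x hx).symm
  refine ⟨(C₁ * C₂) ^ (1 / p), fun u hu _ => ?_⟩
  rw [hwm] at hu ⊢
  -- Pass to a Borel representative for the weighted measure. Since the density is positive on `Ω`,
  -- it agrees with `u` also `μ`-a.e. on `Ω`, so the seminorm, which sees `μ` and not the weighted
  -- measure, is unchanged.
  obtain ⟨u', hu'm, huu'⟩ := hu.1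
  have hae : ∀ᵐ x ∂μ.restrict Ω, u x = u' x := by
    filter_upwards [(ae_withDensity_iff hΦm).1 huu', ae_restrict_mem hΩm] with x hx hxΩ
    refine hx ?_
    rw [hΦeq x hxΩ]
    exact (ENNReal.ofReal_pos.2 (hφpos _ (hpos x hxΩ))).ne'
  have hsemi : fracSeminorm μ Ω s τ p (vWeight Ω φ (γ * p)) u =
      fracSeminorm μ Ω s τ p (vWeight Ω φ (γ * p)) u' := by
    unfold fracSeminorm
    congr 1
    refine lintegral_congr_ae (hae.mono fun y hy => ?_)
    refine lintegral_congr_ae ?_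
    filter_upwards [ae_mono (Measure.restrict_mono_set μ inter_subset_left) hae] with z hz
    rw [hz, hy]
  obtain ⟨a, ha⟩ := h₁ u' hu'm.measurable
  rw [hsemi]
  refine (iInf_le _ a).trans ?_
  rw [eLpNorm_congr_ae (g := fun x => u' x - a) (huu'.mono fun x hx => by simp only [hx]),
    eLpNorm_eq_lintegral_rpow_enorm_toReal (by simpa using hp0) ENNReal.ofReal_ne_top,
    ENNReal.toReal_ofReal hp0.le, fracSeminorm, ENNReal.coe_rpow_of_nonneg _ (by positivity),
    ← ENNReal.mul_rpow_of_nonneg _ _ (by positivity)]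
  gcongr
  have hmeas : Measurable fun x => ‖u' x - a‖ₑ ^ p :=
    ((hu'm.measurable.sub_const a).enorm).pow_const p
  rw [lintegral_withDensity_eq_lintegral_mul _ hΦm hmeas, ENNReal.coe_mul, mul_assoc]
  calc ∫⁻ x in Ω, (Φ * fun x => ‖u' x - a‖ₑ ^ p) x ∂μ
      = ∫⁻ x in Ω, Φ x * ENNReal.ofReal (|u' x - a| ^ p) ∂μ := by
        refine lintegral_congr fun x => ?_
        rw [Pi.mul_apply, ← ENNReal.ofReal_rpow_of_nonneg (abs_nonneg _) hp0.le,
          Real.enorm_eq_ofReal_abs]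
    _ ≤ _ := ha
    _ ≤ _ := by
        gcongr
        refine le_trans (le_of_eq (setLIntegral_congr_fun hΩm fun y hy => ?_)) (h₂ u')
        simp only [hΦeq y hy]
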